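/- Let $H\in\mathbb C^{n_R\times n_T}$ be a matrix without zero columns and with $\operatorname{rank}H=\nu<n_T$. Let $P_1,\dots,P_{n_T}>0$ and $P_{\mathrm{tot}}\ge 0$ be real, and let $H=U_H\Lambda_HV_H^{\mathsf H}$ be any reduced singular value decomposition, that is, $\Lambda_H\in\mathbb R^{\nu\times\nu}$ is diagonal with positive diagonal, $U_H\in\mathbb C^{n_R\times\nu}$, $V_H\in\mathbb C^{n_T\times\nu}$ and $U_H^{\mathsf H}U_H=V_H^{\mathsf H}V_H=I_\nu$. For a Hermitian matrix $A=WDW^{\mathsf H}$ with $W$ unitary and $D$ real diagonal, let $(A)_+=W\max(0,D)W^{\mathsf H}$, with the maximum taken on each diagonal entry. A capacity-achieving covariance matrix is a maximizer of $\log\det(I_{n_R}+HQH^{\mathsf H})$ over all $Q\in\mathbb C^{n_T\times n_T}$ with $Q\ge 0$, $Q_{ii}\le P_i$ for all $i$ (the PAP constraints), and $\operatorname{tr}Q\le P_{\mathrm{tot}}$ (the TP constraint). Then there is exactly one capacity-achieving covariance matrix, and it is obtained by solving the problem $$\begin{aligned}\min_{\check D,\,Q}\quad&-\log\det(I_{n_R}+HQH^{\mathsf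 H})\\ \text{s.t.}\quad&\check D\text{ real diagonal},\ \check D>0,\quad Q\ge 0,\\ &Q_{ii}\le P_i\ (1\le i\le n_T),\qquad \operatorname{tr}Q\le P_{\mathrm{tot}},\\ &V_H^{\mathsf H}QV_H=\Lambda_H^{-1}U_H^{\mathsf H}\bigl(H\check DH^{\mathsf H}-I_{n_R}\bigr)_+U_H\Lambda_H^{-1}.\end{aligned}$$ That is, a matrix $Q$ is capacity-achieving if and only if there is a $\check D$ such that $(\check D,Q)$ is a solution (a minimizer) of this problem; in particular the minimum is attained, and it equals minus the capacity. The TP constraint enters as an inequality, not as an equality. -/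

import Mathlib

open scoped Matrix ComplexOrder

noncomputable section

namespace MIMO

/-- The real diagonal matrix with diagonal `d`, as a complex matrix. -/
def realDiag {n : ℕ} (d : Fin n → ℝ) : Matrix (Fin n) (Fin n) ℂ :=
  Matrix.diagonal fun i => (d i : ℂ)

/-- The positive part of a Hermitian matrix: if `A = U D Uᴴ` with `U` unitary and `D` real
diagonal, then `hermPosPart A = U D₊ Uᴴ`, where `D₊` has the diagonal entries `max 0 (D i i)`
(continuous functional calculus). -/
def hermPosPart {n : ℕ} (A : Matrix (Fin n) (Fin n) ℂ) : Matrix (Fin n) (Fin n) ℂ :=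
  cfc (fun x : ℝ => max 0 x) A

/-- The mutual information `log det (I + H Q Hᴴ)` (in nats). For positive semidefinite `Q` the
determinant is a real number `≥ 1`, so that taking its real part loses nothing. -/
def mutualInfo {nR nT : ℕ} (H : Matrix (Fin nR) (Fin nT) ℂ) (Q : Matrix (Fin nT) (Fin nT) ℂ) :
    ℝ :=
  Real.log ((1 + H * Q * Hᴴ).det).re

/-- The input covariance matrices allowed by the total power bound `Ptot` and the per-antenna
power bounds `P`. -/
def admissible {nT : ℕ} (P : Fin nT → ℝ) (Ptot : ℝ) : Set (Matrix (Fin nT) (Fin nT) ℂ) :=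
  {Q | Q.PosSemidef ∧ (∀ i, (Q i i).re ≤ P i) ∧ Q.trace.re ≤ Ptot}

/-- `Q` attains the capacity, i.e. the maximum of the mutual information over all admissible
input covariance matrices. -/
def IsCapacityAchieving {nR nT : ℕ} (H : Matrix (Fin nR) (Fin nT) ℂ) (P : Fin nT → ℝ) (Ptot : ℝ)
    (Q : Matrix (Fin nT) (Fin nT) ℂ) : Prop :=
  Q ∈ admissible P Ptot ∧ IsMaxOn (mutualInfo H) (admissible P Ptot) Q

/-- `H = U Λ Vᴴ` is a reduced singular value decomposition, where `Λ` is the positive definite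
diagonal matrix with diagonal `s`, and `U`, `V` have orthonormal columns. -/
structure IsReducedSVD {nR nT ν : ℕ} (H : Matrix (Fin nR) (Fin nT) ℂ)
    (U : Matrix (Fin nR) (Fin ν) ℂ) (s : Fin ν → ℝ) (V : Matrix (Fin nT) (Fin ν) ℂ) : Prop where
  pos : ∀ k, 0 < s k
  left : Uᴴ * U = 1
  right : Vᴴ * V = 1
  eq : H = U * realDiag s * Vᴴ

/-- The coupling constraint `Vᴴ Q V = Λ⁻¹ Uᴴ (H Ď Hᴴ - I)₊ U Λ⁻¹`, with `Λ` and `Ď` the diagonal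
matrices with diagonals `s` and `d`. -/
def Coupled {nR nT ν : ℕ} (H : Matrix (Fin nR) (Fin nT) ℂ)
    (U : Matrix (Fin nR) (Fin ν) ℂ) (s : Fin ν → ℝ) (V : Matrix (Fin nT) (Fin ν) ℂ)
    (d : Fin nT → ℝ) (Q : Matrix (Fin nT) (Fin nT) ℂ) : Prop :=
  Vᴴ * Q * V =
    (realDiag s)⁻¹ * Uᴴ * hermPosPart (H * realDiag d * Hᴴ - 1) * U * (realDiag s)⁻¹

/-- The feasible pairs `(Ď, Q)` of the coupled problem; `Ď` is given by its diagonal. -/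
def coupledFeasible {nR nT ν : ℕ} (H : Matrix (Fin nR) (Fin nT) ℂ) (P : Fin nT → ℝ) (Ptot : ℝ)
    (U : Matrix (Fin nR) (Fin ν) ℂ) (s : Fin ν → ℝ) (V : Matrix (Fin nT) (Fin ν) ℂ) :
    Set ((Fin nT → ℝ) × Matrix (Fin nT) (Fin nT) ℂ) :=
  {x | (∀ i, 0 < x.1 i) ∧ x.2.PosSemidef ∧ (∀ i, (x.2 i i).re ≤ P i) ∧ x.2.trace.re ≤ Ptot ∧
    Coupled H U s V x.1 x.2}

/-- `(Ď, Q)` solves the coupled problem: it minimizes `-log det (I + H Q Hᴴ)` over the feasible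
pairs. -/
def IsCoupledSolution {nR nT ν : ℕ} (H : Matrix (Fin nR) (Fin nT) ℂ) (P : Fin nT → ℝ) (Ptot : ℝ)
    (U : Matrix (Fin nR) (Fin ν) ℂ) (s : Fin ν → ℝ) (V : Matrix (Fin nT) (Fin ν) ℂ)
    (d : Fin nT → ℝ) (Q : Matrix (Fin nT) (Fin nT) ℂ) : Prop :=
  (d, Q) ∈ coupledFeasible H P Ptot U s V ∧
    IsMinOn (fun x : (Fin nT → ℝ) × Matrix (Fin nT) (Fin nT) ℂ => -mutualInfo H x.2)
      (coupledFeasible H P Ptot U s V) (d, Q)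

end MIMO

end

noncomputable section

namespace MIMO

/-! A maximizer `Q` exists by compactness. With `K = 1 + H Q Hᴴ` and `G = Hᴴ K⁻¹ H`, first-order
optimality says that `Q` also maximizes the linear function `R ↦ re tr (G R)` over the admissible
set. Duality for this linear problem yields a real diagonal `W` with `W - G ≥ 0` and `(W - G) Q = 0`
(`IsCapacityAchieving.exists_multiplier`). Since `H` has no zero column, `G` has positive diagonal,
hence so does `W`.

Put `Ď = W⁻¹`. A Schur complement turns `W - G ≥ 0` into `K - H Ď Hᴴ ≥ 0`, and slackness makes its
product with `H Q Hᴴ` vanish. So `H Ď Hᴴ - 1 = H Q Hᴴ - (K - H Ď Hᴴ)` is a Jordan decomposition with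
positive part `H Q Hᴴ`; the SVD converts this into the coupling constraint. Every maximizer is thus
feasible for the coupled problem, whose feasible `Q` are all admissible, so both problems have the
same optimal `Q`.

Uniqueness: strict concavity of `log det` fixes only `H Q Hᴴ`; invertibility of `W` does the rest.
-/

/-! ### Positive semidefinite matrices: positive parts and vanishing products -/

open scoped MatrixOrder in
lemma hermPosPart_eq_of_eq_sub {n : ℕ} {A B C : Matrix (Fin n) (Fin n) ℂ} (hB : B.PosSemidef)
    (hC : C.PosSemidef) (hA : A = B - C) (hBC : B * C = 0) : hermPosPart A = B := by
  have h := (CFC.posPart_negPart_unique hA hBC hB.nonneg hC.nonneg).1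
  rw [CFC.posPart_def, cfcₙ_eq_cfc] at h
  rw [← h, hermPosPart]
  simp only [posPart_def, sup_comm]

open scoped MatrixOrder in
lemma _root_.Matrix.PosSemidef.exists_eq_conjTranspose_mul_self {n : ℕ}
    {A : Matrix (Fin n) (Fin n) ℂ} (hA : A.PosSemidef) :
    ∃ B : Matrix (Fin n) (Fin n) ℂ, A = Bᴴ * B :=
  CStarAlgebra.nonneg_iff_eq_star_mul_self.mp hA.nonneg

/-- For `Z = Bᴴ B` and `Q = Cᴴ C` the trace is the squared Frobenius norm of `B Cᴴ`. -/
lemma mul_eq_zero_of_trace_mul_nonpos {n : ℕ} {Z Q : Matrix (Fin n) (Fin n) ℂ}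
    (hZ : Z.PosSemidef) (hQ : Q.PosSemidef) (h : (Z * Q).trace.re ≤ 0) : Z * Q = 0 := by
  obtain ⟨B, rfl⟩ := hZ.exists_eq_conjTranspose_mul_self
  obtain ⟨C, rfl⟩ := hQ.exists_eq_conjTranspose_mul_self
  have e : (Bᴴ * B * (Cᴴ * C)).trace = ((B * Cᴴ)ᴴ * (B * Cᴴ)).trace := by
    rw [← Matrix.mul_assoc, Matrix.trace_mul_comm]
    simp [Matrix.mul_assoc]
  have hn := (Matrix.posSemidef_conjTranspose_mul_self (B * Cᴴ)).trace_nonneg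
  rw [← e] at hn
  have h0 : (Bᴴ * B * (Cᴴ * C)).trace = 0 := by
    rw [Complex.le_def] at hn
    exact Complex.ext (le_antisymm h hn.1) hn.2.symm
  rw [e, Matrix.trace_conjTranspose_mul_self_eq_zero_iff] at h0
  calc Bᴴ * B * (Cᴴ * C) = Bᴴ * (B * Cᴴ) * C := by simp only [Matrix.mul_assoc]
    _ = 0 := by simp [h0]

/-! ### Strict concavity of log det and first-order optimality -/

/-- Equality case of AM-GM, from `log x ≤ x - 1` with equality only at `1`. -/
lemma eq_one_of_sum_le_card_of_one_le_prod {n : ℕ} {e : Fin n → ℝ} (he : ∀ i, 0 < e i)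
    (hs : ∑ i, e i ≤ n) (hp : 1 ≤ ∏ i, e i) (i : Fin n) : e i = 1 := by
  have hlog : 0 ≤ ∑ i, Real.log (e i) := by
    rw [← Real.log_prod (fun i _ => (he i).ne')]
    exact Real.log_nonneg hp
  have h0 : ∀ i ∈ Finset.univ, 0 ≤ e i - 1 - Real.log (e i) := fun i _ =>
    sub_nonneg.2 (Real.log_le_sub_one_of_pos (he i))
  have hsum : ∑ i, (e i - 1 - Real.log (e i)) = 0 := by
    refine le_antisymm ?_ (Finset.sum_nonneg h0)
    simp only [Finset.sum_sub_distrib, Finset.sum_const, Finset.card_univ, Fintype.card_fin,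
      nsmul_eq_mul, mul_one]
    linarith
  have := (Finset.sum_eq_zero_iff_of_nonneg h0).1 hsum i (Finset.mem_univ i)
  by_contra hne
  have := Real.log_lt_sub_one_of_pos (he i) hne
  linarith

lemma eq_one_of_trace_le_of_one_le_det {n : ℕ} {M : Matrix (Fin n) (Fin n) ℂ} (hM : M.PosDef)
    (ht : M.trace.re ≤ n) (hd : 1 ≤ M.det.re) : M = 1 := by
  have h1 := eq_one_of_sum_le_card_of_one_le_prod (e := hM.1.eigenvalues) hM.eigenvalues_pos
    (by
      have := hM.1.trace_eq_sum_eigenvalues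
      rw [this] at ht
      simpa using ht)
    (by
      have := hM.1.det_eq_prod_eigenvalues
      rw [this] at hd
      rw [← RCLike.ofReal_prod] at hd
      exact hd)
  have h := hM.1.spectral_theorem
  have hone : (RCLike.ofReal ∘ hM.1.eigenvalues : Fin n → ℂ) = 1 := by
    ext i; simp [h1 i]
  rw [hone] at h
  rw [h]
  simp

lemma det_re_pos {n : ℕ} {K : Matrix (Fin n) (Fin n) ℂ} (hK : K.PosDef) : 0 < K.det.re :=
  (Complex.lt_def.1 hK.det_pos).1

lemma det_eq_ofReal_re {n : ℕ} {K : Matrix (Fin n) (Fin n) ℂ} (hK : K.PosDef) :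
    K.det = (K.det.re : ℂ) :=
  Complex.ext rfl (by simpa using (Complex.lt_def.1 hK.det_pos).2.symm)

/-- Equality case of the tangent inequality of the strictly concave function `log det`. -/
lemma eq_of_trace_inv_mul_sub_nonpos {n : ℕ} {K L : Matrix (Fin n) (Fin n) ℂ} (hK : K.PosDef)
    (hL : L.PosDef) (ht : (K⁻¹ * (L - K)).trace.re ≤ 0) (hd : K.det.re ≤ L.det.re) : L = K := by
  -- Congruence by `B` sends `K` to `1`, and `L` to a matrix of trace at most `n` and determinant at
  -- least `1`.
  obtain ⟨B, hB⟩ := hK.inv.posSemidef.exists_eq_conjTranspose_mul_self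
  have hKu : IsUnit K.det := (Matrix.isUnit_iff_isUnit_det _).1 hK.isUnit
  have hBu : IsUnit B := by
    have := hK.inv.isUnit
    rw [hB] at this
    rw [Matrix.isUnit_iff_isUnit_det] at this ⊢
    rw [Matrix.det_mul] at this
    exact isUnit_of_mul_isUnit_right this
  have hdet : K.det * (star B.det * B.det) = 1 := by
    have := congrArg Matrix.det hB
    rw [Matrix.det_mul, Matrix.det_conjTranspose] at this
    rw [← this, ← Matrix.det_mul, Matrix.mul_nonsing_inv _ hKu, Matrix.det_one]
  have hM : (B * L * Bᴴ).PosDef := by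
    refine hL.mul_mul_conjTranspose_same ?_
    exact Matrix.vecMul_injective_of_isUnit hBu
  have hKr := det_eq_ofReal_re hK
  have hLr := det_eq_ofReal_re hL
  have h1 : B * L * Bᴴ = 1 := by
    refine eq_one_of_trace_le_of_one_le_det hM ?_ ?_
    · have : (B * L * Bᴴ).trace = (K⁻¹ * (L - K)).trace + n := by
        rw [Matrix.mul_sub, Matrix.nonsing_inv_mul _ hKu, Matrix.trace_sub, Matrix.trace_mul_cycle,
          hB]
        simp
      rw [this]
      simpa using ht
    · have hbb : star B.det * B.det = (Complex.normSq B.det : ℂ) := by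
        rw [mul_comm]; exact Complex.mul_conj _
      have : (B * L * Bᴴ).det = ((L.det.re * Complex.normSq B.det : ℝ) : ℂ) := by
        rw [Matrix.det_mul, Matrix.det_mul, Matrix.det_conjTranspose, mul_comm B.det, mul_assoc,
          mul_comm B.det, hbb, hLr]
        simp
      rw [this, Complex.ofReal_re]
      rw [hbb, hKr] at hdet
      have hdet' : K.det.re * Complex.normSq B.det = 1 := by exact_mod_cast hdet
      rw [← hdet']
      exact mul_le_mul_of_nonneg_right hd (Complex.normSq_nonneg _)
  have h2 : B * K * Bᴴ = 1 := by
    have hBB : Bᴴ * (B * K) = 1 := by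
      rw [← Matrix.mul_assoc, ← hB, Matrix.nonsing_inv_mul _ hKu]
    exact mul_eq_one_comm.1 hBB
  have hBs : IsUnit Bᴴ := hBu.star
  exact hBu.mul_left_cancel (hBs.mul_right_cancel (h1.trans h2.symm))

lemma posDef_one_add {nR nT : ℕ} (H : Matrix (Fin nR) (Fin nT) ℂ) {Q : Matrix (Fin nT) (Fin nT) ℂ}
    (hQ : Q.PosSemidef) : (1 + H * Q * Hᴴ).PosDef :=
  Matrix.PosDef.one.add_posSemidef (hQ.mul_mul_conjTranspose_same H)

lemma nonpos_of_forall_mul_add_sq_nonpos {a : ℝ} {q : ℝ → ℝ} (hq : Continuous q)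
    (h : ∀ t : ℝ, 0 < t → t ≤ 1 → a * t + q t * t ^ 2 ≤ 0) : a ≤ 0 := by
  have hlim : Filter.Tendsto (fun t => a + q t * t) (nhdsWithin 0 (Set.Ioi 0)) (nhds a) := by
    have : Continuous fun t => a + q t * t := by fun_prop
    simpa using (this.tendsto 0).mono_left nhdsWithin_le_nhds
  refine le_of_tendsto hlim ?_
  filter_upwards [Ioc_mem_nhdsGT (zero_lt_one (α := ℝ))] with t ht
  have := h t ht.1 ht.2
  by_contra! hc
  nlinarith [mul_pos hc ht.1]

lemma trace_inv_mul_nonpos_of_det_le {n : ℕ} {K M : Matrix (Fin n) (Fin n) ℂ} (hK : K.PosDef)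
    (h : ∀ t : ℝ, 0 < t → t ≤ 1 → (K + t • M).det.re ≤ K.det.re) :
    (K⁻¹ * M).trace.re ≤ 0 := by
  have hKu : IsUnit K.det := (Matrix.isUnit_iff_isUnit_det _).1 hK.isUnit
  -- The remainder in `det (1 + t A) = 1 + t tr A + p(t) t²`, where `A = K⁻¹ M`.
  set p := (Matrix.det (1 + (Polynomial.X : Polynomial ℂ) • (K⁻¹ * M).map Polynomial.C)).divX.divX
  refine nonpos_of_forall_mul_add_sq_nonpos (q := fun t => (p.eval (t : ℂ)).re)
    (by fun_prop) fun t h0 h1 => ?_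
  have e : K + t • M = K * (1 + (t : ℂ) • (K⁻¹ * M)) := by
    rw [Matrix.mul_add, Matrix.mul_one, Matrix.mul_smul, ← Matrix.mul_assoc,
      Matrix.mul_nonsing_inv _ hKu, Matrix.one_mul, Complex.coe_smul]
  have h2 := h t h0 h1
  rw [e, Matrix.det_mul, det_eq_ofReal_re hK, Complex.re_ofReal_mul, Complex.ofReal_re,
    Matrix.det_one_add_smul] at h2
  have h3 := le_of_mul_le_mul_left (h2.trans_eq (mul_one _).symm) (det_re_pos hK)
  rw [← Complex.ofReal_pow] at h3
  simp only [Complex.add_re, Complex.one_re, Complex.re_mul_ofReal] at h3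
  linarith

lemma convex_admissible {nT : ℕ} (P : Fin nT → ℝ) (Ptot : ℝ) : Convex ℝ (admissible P Ptot) := by
  rintro A ⟨hA, hA1, hA2⟩ B ⟨hB, hB1, hB2⟩ a b ha hb hab
  refine ⟨(hA.smul ha).add (hB.smul hb), fun i => ?_, ?_⟩
  · simp only [Matrix.add_apply, Matrix.smul_apply, Complex.add_re, Complex.real_smul,
      Complex.re_ofReal_mul]
    calc _ ≤ a * P i + b * P i := by gcongr <;> [exact hA1 i; exact hB1 i]
      _ = P i := by rw [← add_mul, hab, one_mul]
  · simp only [Matrix.trace_add, Matrix.trace_smul, Complex.add_re, Complex.real_smul,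
      Complex.re_ofReal_mul]
    calc _ ≤ a * Ptot + b * Ptot := by gcongr
      _ = Ptot := by rw [← add_mul, hab, one_mul]

section

variable {nR nT : ℕ} {H : Matrix (Fin nR) (Fin nT) ℂ} {P : Fin nT → ℝ} {Ptot : ℝ}
  {Q R : Matrix (Fin nT) (Fin nT) ℂ}

lemma IsCapacityAchieving.det_le (hQ : IsCapacityAchieving H P Ptot Q)
    (hR : R ∈ admissible P Ptot) : (1 + H * R * Hᴴ).det.re ≤ (1 + H * Q * Hᴴ).det.re :=
  (Real.log_le_log_iff (det_re_pos (posDef_one_add H hR.1))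
    (det_re_pos (posDef_one_add H hQ.1.1))).1 (hQ.2 hR)

lemma IsCapacityAchieving.trace_nonpos (hQ : IsCapacityAchieving H P Ptot Q)
    (hR : R ∈ admissible P Ptot) :
    ((1 + H * Q * Hᴴ)⁻¹ * (H * (R - Q) * Hᴴ)).trace.re ≤ 0 := by
  refine trace_inv_mul_nonpos_of_det_le (posDef_one_add H hQ.1.1) fun t h0 h1 => ?_
  have hm := convex_admissible P Ptot hQ.1 hR (sub_nonneg.2 h1) h0.le (by ring)
  have := hQ.det_le hm
  convert this using 3
  simp only [Matrix.mul_sub, Matrix.sub_mul, Matrix.mul_add, Matrix.add_mul, Matrix.mul_smul,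
    Matrix.smul_mul, sub_smul, smul_sub, one_smul]
  abel

lemma IsCapacityAchieving.mul_mul_conjTranspose_eq (hQ : IsCapacityAchieving H P Ptot Q)
    (hR : IsCapacityAchieving H P Ptot R) : H * R * Hᴴ = H * Q * Hᴴ := by
  refine add_left_cancel (a := 1) (eq_of_trace_inv_mul_sub_nonpos (posDef_one_add H hQ.1.1)
    (posDef_one_add H hR.1.1) ?_ (hR.det_le hQ.1))
  convert hQ.trace_nonpos hR.1 using 4
  simp only [Matrix.mul_sub, Matrix.sub_mul]
  abel

end

/-! ### Compactness and existence of a maximizer -/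

lemma isClosed_posSemidef (n : ℕ) : IsClosed {A : Matrix (Fin n) (Fin n) ℂ | A.PosSemidef} := by
  simp only [Matrix.posSemidef_iff_dotProduct_mulVec, Set.ofPred_and, Set.ofPred_forall,
    Matrix.IsHermitian]
  refine IsClosed.inter (isClosed_eq (by fun_prop) (by fun_prop)) (isClosed_iInter fun x => ?_)
  exact isClosed_le (by fun_prop) (by fun_prop)

/-- The 2×2 minors give `|A i j|² ≤ A i i * A j j`, so diagonal bounds control every entry. -/
lemma norm_apply_le_add_of_posSemidef {n : ℕ} {A : Matrix (Fin n) (Fin n) ℂ} (hA : A.PosSemidef)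
    (i j : Fin n) : ‖A i j‖ ≤ (A i i).re + (A j j).re := by
  have h := (hA.submatrix ![i, j]).det_nonneg
  rw [Matrix.det_fin_two] at h
  simp only [Matrix.submatrix_apply, Matrix.cons_val_zero, Matrix.cons_val_one] at h
  have hi := Complex.le_def.1 (hA.diag_nonneg (i := i))
  have hj := Complex.le_def.1 (hA.diag_nonneg (i := j))
  have hji : A j i = star (A i j) := (hA.1.apply j i).symm
  have hm : A i j * A j i = ((‖A i j‖ ^ 2 : ℝ) : ℂ) := by
    rw [hji, ← Complex.normSq_eq_norm_sq]; exact Complex.mul_conj _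
  rw [hm] at h
  have h' := (Complex.le_def.1 h).1
  simp only [Complex.zero_re, Complex.zero_im, Complex.sub_re, Complex.mul_re,
    Complex.ofReal_re] at h' hi hj
  rw [← hi.2] at h'
  refine le_of_sq_le_sq ?_ (add_nonneg hi.1 hj.1)
  nlinarith [mul_nonneg hi.1 hj.1, hi.1, hj.1]

lemma isCompact_admissible {nT : ℕ} (P : Fin nT → ℝ) (Ptot : ℝ) :
    IsCompact (admissible P Ptot) := by
  have hK : IsCompact (Set.univ.pi fun i => Set.univ.pi fun j =>
      Metric.closedBall (0 : ℂ) (P i + P j) : Set (Matrix (Fin nT) (Fin nT) ℂ)) :=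
    isCompact_univ_pi fun i => isCompact_univ_pi fun j => isCompact_closedBall _ _
  have h1 : IsClosed {Q : Matrix (Fin nT) (Fin nT) ℂ | ∀ i, (Q i i).re ≤ P i} := by
    simp only [Set.ofPred_forall]
    exact isClosed_iInter fun i => isClosed_le (by fun_prop) (by fun_prop)
  have h2 : IsClosed {Q : Matrix (Fin nT) (Fin nT) ℂ | Q.trace.re ≤ Ptot} :=
    isClosed_le (by fun_prop) (by fun_prop)
  refine hK.of_isClosed_subset ((isClosed_posSemidef nT).inter (h1.inter h2)) ?_
  · rintro Q ⟨hQ, h1, -⟩ i - j -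
    rw [mem_closedBall_zero_iff]
    exact (norm_apply_le_add_of_posSemidef hQ i j).trans (add_le_add (h1 i) (h1 j))

lemma exists_isCapacityAchieving {nR nT : ℕ} (H : Matrix (Fin nR) (Fin nT) ℂ) {P : Fin nT → ℝ}
    (hP : ∀ i, 0 < P i) {Ptot : ℝ} (hPtot : 0 ≤ Ptot) : ∃ Q, IsCapacityAchieving H P Ptot Q := by
  refine (isCompact_admissible P Ptot).exists_isMaxOn
    ⟨0, Matrix.PosSemidef.zero, fun i => by simpa using (hP i).le, by simpa using hPtot⟩ ?_
  refine ContinuousOn.log (Continuous.continuousOn (by fun_prop)) fun Q hQ => ?_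
  exact (det_re_pos (posDef_one_add H hQ.1)).ne'

/-! ### Lagrangian duality for a linear objective -/

open scoped MatrixOrder Matrix.Norms.L2Operator in
lemma exists_smul_one_sub_posSemidef {n : ℕ} {A : Matrix (Fin n) (Fin n) ℂ}
    (hA : A.IsHermitian) : ∃ c : ℝ, ((c : ℂ) • 1 - A).PosSemidef := by
  refine ⟨‖A‖, ?_⟩
  have h := IsSelfAdjoint.le_algebraMap_norm_self (a := A) hA
  rw [Matrix.le_iff, Algebra.algebraMap_eq_smul_one] at h
  simpa using h

/-- Self-duality of the semidefinite cone, tested on rank-one matrices. -/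
lemma posSemidef_of_forall_trace_mul_nonneg {n : ℕ} {A : Matrix (Fin n) (Fin n) ℂ}
    (hA : A.IsHermitian)
    (h : ∀ Q : Matrix (Fin n) (Fin n) ℂ, Q.PosSemidef → 0 ≤ (A * Q).trace.re) :
    A.PosSemidef := by
  refine .of_dotProduct_mulVec_nonneg hA fun x => ?_
  have h1 := h _ (Matrix.posSemidef_vecMulVec_self_star x)
  rw [Matrix.mul_vecMulVec, Matrix.trace_vecMulVec, dotProduct_comm] at h1
  exact Complex.le_def.2 ⟨h1, (hA.im_star_dotProduct_mulVec_self x).symm⟩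

lemma nonpos_of_forall_add_mul_lt {a b c : ℝ} (h : ∀ t : ℝ, 0 ≤ t → a + t * b < c) : b ≤ 0 := by
  by_contra! hb
  have h0 := h 0 le_rfl
  have := h ((c - a) / b) (div_nonneg (by linarith) hb.le)
  rw [div_mul_cancel₀ _ hb.ne'] at this
  linarith

lemma trace_realDiag_mul {n : ℕ} (w : Fin n → ℝ) (Q : Matrix (Fin n) (Fin n) ℂ) :
    (realDiag w * Q).trace.re = ∑ i, w i * (Q i i).re := by
  simp [Matrix.trace, realDiag, Matrix.diagonal_mul]

lemma isHermitian_realDiag {n : ℕ} (w : Fin n → ℝ) : (realDiag w).IsHermitian := by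
  rw [realDiag, Matrix.isHermitian_diagonal_iff]
  intro i
  exact Complex.conj_ofReal _

/-- The values of power consumption and of the linear objective `Q ↦ re tr (G Q)` that are strictly
worse than the values at some positive semidefinite matrix. -/
def dominatedValues {n : ℕ} (G : Matrix (Fin n) (Fin n) ℂ) : Set ((Fin n → ℝ) × ℝ × ℝ) :=
  {x | ∃ Q : Matrix (Fin n) (Fin n) ℂ, Q.PosSemidef ∧ (∀ i, (Q i i).re < x.1 i) ∧
    Q.trace.re < x.2.1 ∧ x.2.2 < (G * Q).trace.re}

lemma isOpen_dominatedValues {n : ℕ} (G : Matrix (Fin n) (Fin n) ℂ) :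
    IsOpen (dominatedValues G) := by
  simp only [dominatedValues, Set.ofPred_exists, Set.ofPred_and, Set.ofPred_forall]
  refine isOpen_iUnion fun Q => isOpen_const.inter (IsOpen.inter (isOpen_iInter_of_finite fun i =>
    isOpen_lt (by fun_prop) (by fun_prop)) (IsOpen.inter (isOpen_lt (by fun_prop) (by fun_prop))
    (isOpen_lt (by fun_prop) (by fun_prop))))

lemma convex_dominatedValues {n : ℕ} (G : Matrix (Fin n) (Fin n) ℂ) :
    Convex ℝ (dominatedValues G) := by
  rw [convex_iff_forall_pos]
  rintro x ⟨A, hA, hA1, hA2, hA3⟩ y ⟨B, hB, hB1, hB2, hB3⟩ a b ha hb -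
  refine ⟨a • A + b • B, (hA.smul ha.le).add (hB.smul hb.le), fun i => ?_, ?_, ?_⟩
  · simp only [Matrix.add_apply, Matrix.smul_apply, Complex.add_re, Complex.real_smul,
      Complex.re_ofReal_mul, Prod.fst_add, Prod.smul_fst, Pi.add_apply, Pi.smul_apply, smul_eq_mul]
    exact add_lt_add (mul_lt_mul_of_pos_left (hA1 i) ha) (mul_lt_mul_of_pos_left (hB1 i) hb)
  · simp only [Matrix.trace_add, Matrix.trace_smul, Complex.add_re, Complex.real_smul,
      Complex.re_ofReal_mul, Prod.snd_add, Prod.smul_snd, Prod.fst_add, Prod.smul_fst, smul_eq_mul]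
    exact add_lt_add (mul_lt_mul_of_pos_left hA2 ha) (mul_lt_mul_of_pos_left hB2 hb)
  · simp only [Matrix.mul_add, Matrix.mul_smul, Matrix.trace_add, Matrix.trace_smul,
      Complex.add_re, Complex.real_smul, Complex.re_ofReal_mul, Prod.snd_add, Prod.smul_snd,
      smul_eq_mul]
    exact add_lt_add (mul_lt_mul_of_pos_left hA3 ha) (mul_lt_mul_of_pos_left hB3 hb)

/-- Strong duality for the maximization of a linear function over the admissible matrices. -/
lemma exists_realDiag_sub_posSemidef_of_pos {n : ℕ} {G : Matrix (Fin n) (Fin n) ℂ}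
    (hG : G.IsHermitian) {P : Fin n → ℝ} (hP : ∀ i, 0 < P i) {Ptot : ℝ} (hPtot : 0 < Ptot) {v : ℝ}
    (hv : ∀ Q ∈ admissible P Ptot, (G * Q).trace.re ≤ v) :
    ∃ w : Fin n → ℝ, (realDiag w - G).PosSemidef ∧
      ∀ Q ∈ admissible P Ptot, v ≤ (G * Q).trace.re → ((realDiag w - G) * Q).trace.re ≤ 0 := by
  obtain ⟨f, hf⟩ := geometric_hahn_banach_open_point (x := ((P, Ptot, v) : (Fin n → ℝ) × ℝ × ℝ))
    (convex_dominatedValues G) (isOpen_dominatedValues G) (by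
      rintro ⟨Q, hQ, h1, h2, h3⟩
      exact (hv Q ⟨hQ, fun i => (h1 i).le, h2.le⟩).not_gt h3)
  set a : Fin n → ℝ := fun i => f (Pi.single i 1, 0, 0) with ha
  set b : ℝ := f (0, 1, 0) with hb
  set c : ℝ := f (0, 0, 1) with hc
  have hfx : ∀ x : (Fin n → ℝ) × ℝ × ℝ, f x = ∑ i, x.1 i * a i + x.2.1 * b + x.2.2 * c := by
    intro x
    have hx : x = ∑ i, x.1 i • ((Pi.single i 1, 0, 0) : (Fin n → ℝ) × ℝ × ℝ)
        + x.2.1 • (0, 1, 0) + x.2.2 • (0, 0, 1) := by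
      ext j
      · simp [Prod.fst_sum, Finset.sum_apply, Pi.single_apply]
      · simp [Prod.snd_sum]
      · simp [Prod.snd_sum]
    conv_lhs => rw [hx]
    simp only [map_add, map_sum, map_smul, smul_eq_mul, ha, hb, hc]
  have hbase : ∀ (u : Fin n → ℝ) (t r : ℝ), (∀ i, 0 < u i) → 0 < t → r < 0 →
      ∑ i, u i * a i + t * b + r * c < f (P, Ptot, v) := by
    intro u t r hu ht hr
    rw [← hfx (u, t, r)]
    exact hf _ ⟨0, .zero, by simpa using hu, by simpa using ht, by simpa using hr⟩
  have ha0 : ∀ i, a i ≤ 0 := by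
    intro i
    refine nonpos_of_forall_add_mul_lt (a := ∑ i, a i + b - c) (c := f (P, Ptot, v)) fun t ht => ?_
    have := hbase (1 + Pi.single i t) 1 (-1) (fun j => ?_) one_pos (by norm_num)
    · simp only [Pi.add_apply, Pi.one_apply, add_mul, Finset.sum_add_distrib, Pi.single_apply,
        ite_mul, zero_mul, Finset.sum_ite_eq', Finset.mem_univ, if_true, one_mul] at this
      linarith
    · rw [Pi.add_apply, Pi.one_apply, Pi.single_apply]
      split_ifs <;> linarith
  have hb0 : b ≤ 0 := by
    refine nonpos_of_forall_add_mul_lt (a := ∑ i, a i + b - c) (c := f (P, Ptot, v)) fun t ht => ?_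
    have := hbase 1 (1 + t) (-1) (fun j => one_pos) (by linarith) (by norm_num)
    simp only [Pi.one_apply, one_mul] at this
    linarith
  have hc0 : -c ≤ 0 := by
    refine nonpos_of_forall_add_mul_lt (a := ∑ i, a i + b - c) (c := f (P, Ptot, v)) fun t ht => ?_
    have := hbase 1 1 (-1 - t) (fun j => one_pos) one_pos (by linarith)
    simp only [Pi.one_apply, one_mul] at this
    linarith
  have hq : ∀ Q : Matrix (Fin n) (Fin n) ℂ, Q.PosSemidef →
      ∑ i, (Q i i).re * a i + Q.trace.re * b + (G * Q).trace.re * c ≤ f (P, Ptot, v) := by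
    intro Q hQ
    have hlim : Filter.Tendsto (fun ε : ℝ => ∑ i, ((Q i i).re + ε) * a i + (Q.trace.re + ε) * b
        + ((G * Q).trace.re - ε) * c) (nhdsWithin 0 (Set.Ioi 0))
        (nhds (∑ i, (Q i i).re * a i + Q.trace.re * b + (G * Q).trace.re * c)) := by
      refine Filter.Tendsto.mono_left ?_ nhdsWithin_le_nhds
      refine Continuous.tendsto' (by fun_prop) _ _ (by simp)
    refine le_of_tendsto hlim ?_
    filter_upwards [self_mem_nhdsWithin] with ε hε
    have hε' : 0 < ε := hε
    have := hf (fun i => (Q i i).re + ε, Q.trace.re + ε, (G * Q).trace.re - ε)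
      ⟨Q, hQ, fun i => by simpa using hε', by simpa using hε', by simpa using hε'⟩
    rw [hfx] at this
    exact this.le
  have hp0 : 0 ≤ f (P, Ptot, v) := by simpa using hq 0 .zero
  -- The semidefinite cone is stable under scaling, so a linear function bounded above on it is
  -- nonpositive.
  have hq0 : ∀ Q : Matrix (Fin n) (Fin n) ℂ, Q.PosSemidef →
      ∑ i, (Q i i).re * a i + Q.trace.re * b + (G * Q).trace.re * c ≤ 0 := by
    intro Q hQ
    refine nonpos_of_forall_add_mul_lt (a := 0) (c := f (P, Ptot, v) + 1) fun t ht => ?_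
    have := hq (t • Q) (hQ.smul ht)
    simp only [Matrix.smul_apply, Complex.real_smul, Complex.re_ofReal_mul, Matrix.mul_smul,
      Matrix.trace_smul, mul_assoc, ← Finset.mul_sum] at this
    rw [← mul_add, ← mul_add] at this
    linarith
  -- Slater's condition: `Q = 0` meets all power bounds strictly, so `c = 0` would give `f (P, Ptot,
  -- v) < f (P, Ptot, v)`.
  have hcpos : 0 < c := by
    refine lt_of_le_of_ne (neg_nonpos.1 hc0) fun hc' => ?_
    have hlt := hbase P Ptot (-1) hP hPtot (by norm_num)
    rw [hfx, ← hc'] at hlt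
    simp at hlt
  have htr : ∀ Q : Matrix (Fin n) (Fin n) ℂ, Q.trace.re = ∑ i, (Q i i).re := fun Q => by
    simp [Matrix.trace]
  -- The per-antenna multiplier `-a i / c` plus the total-power multiplier `-b / c`; they merge
  -- because the trace is the sum of the diagonal.
  set w : Fin n → ℝ := fun i => -(a i + b) / c with hw
  have hZ : ∀ Q : Matrix (Fin n) (Fin n) ℂ, c * ((realDiag w - G) * Q).trace.re =
      -(∑ i, (Q i i).re * a i + Q.trace.re * b + (G * Q).trace.re * c) := by
    intro Q
    have h1 : c * ∑ i, w i * (Q i i).re = -(∑ i, (Q i i).re * a i + Q.trace.re * b) := by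
      rw [htr, Finset.sum_mul, ← Finset.sum_add_distrib, ← Finset.sum_neg_distrib, Finset.mul_sum]
      refine Finset.sum_congr rfl fun i _ => ?_
      simp only [hw]
      field_simp
    rw [Matrix.sub_mul, Matrix.trace_sub, Complex.sub_re, trace_realDiag_mul, mul_sub, h1]
    ring
  refine ⟨w, posSemidef_of_forall_trace_mul_nonneg ((isHermitian_realDiag w).sub hG) fun Q hQ => ?_,
    fun Q hQ hvQ => ?_⟩
  · refine nonneg_of_mul_nonneg_right ?_ hcpos
    rw [hZ]
    exact neg_nonneg.2 (hq0 Q hQ)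
  · refine nonpos_of_mul_nonpos_right ?_ hcpos
    rw [hZ, neg_nonpos]
    rw [hfx] at hp0
    refine hp0.trans (add_le_add (add_le_add (Finset.sum_le_sum fun i _ => ?_) ?_) ?_)
    · exact mul_le_mul_of_nonpos_right (hQ.2.1 i) (ha0 i)
    · exact mul_le_mul_of_nonpos_right hQ.2.2 hb0
    · exact mul_le_mul_of_nonneg_right hvQ hcpos.le

lemma exists_realDiag_sub_posSemidef {n : ℕ} {G : Matrix (Fin n) (Fin n) ℂ}
    (hG : G.IsHermitian) {P : Fin n → ℝ} (hP : ∀ i, 0 < P i) {Ptot : ℝ} (hPtot : 0 ≤ Ptot) {v : ℝ}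
    (hv : ∀ Q ∈ admissible P Ptot, (G * Q).trace.re ≤ v) :
    ∃ w : Fin n → ℝ, (realDiag w - G).PosSemidef ∧
      ∀ Q ∈ admissible P Ptot, v ≤ (G * Q).trace.re → (realDiag w - G) * Q = 0 := by
  rcases hPtot.lt_or_eq with h | rfl
  · obtain ⟨w, hw, hQ⟩ := exists_realDiag_sub_posSemidef_of_pos hG hP h hv
    exact ⟨w, hw, fun Q hQm hvQ => mul_eq_zero_of_trace_mul_nonpos hw hQm.1 (hQ Q hQm hvQ)⟩
  -- Slater's condition fails at `Ptot = 0`, but then `0` is the only admissible matrix and any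
  -- diagonal matrix dominating `G` will do.
  · obtain ⟨c, hc⟩ := exists_smul_one_sub_posSemidef hG
    refine ⟨fun _ => c, ?_, fun Q hQ _ => ?_⟩
    · rwa [realDiag, ← Matrix.smul_one_eq_diagonal]
    · have h0 := mul_eq_zero_of_trace_mul_nonpos .one hQ.1 (by simpa using hQ.2.2)
      rw [Matrix.one_mul] at h0
      rw [h0, Matrix.mul_zero]

/-! ### KKT conditions, uniqueness and the coupling equation -/

section

variable {nR nT : ℕ} {H : Matrix (Fin nR) (Fin nT) ℂ} {P : Fin nT → ℝ} {Ptot : ℝ}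
  {Q R : Matrix (Fin nT) (Fin nT) ℂ}

lemma conjTranspose_mul_mul_apply_self_re_pos {K : Matrix (Fin nR) (Fin nR) ℂ} (hK : K.PosDef)
    {j : Fin nT} (hj : ∃ i, H i j ≠ 0) : 0 < ((Hᴴ * K * H) j j).re := by
  have hx : (fun i => H i j) ≠ 0 := fun h => hj.elim fun i hi => hi (congrFun h i)
  have e : (Hᴴ * K * H) j j = star (fun i => H i j) ⬝ᵥ (K *ᵥ fun i => H i j) := by
    rw [Matrix.mul_assoc]
    rfl
  rw [e]
  exact (Complex.lt_def.1 (hK.dotProduct_mulVec_pos hx)).1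

/-- The Karush-Kuhn-Tucker conditions; `realDiag w` collects the multipliers of the power
constraints. -/
lemma IsCapacityAchieving.exists_multiplier (hQ : IsCapacityAchieving H P Ptot Q)
    (hcol : ∀ j, ∃ i, H i j ≠ 0) (hP : ∀ i, 0 < P i) (hPtot : 0 ≤ Ptot) :
    ∃ w : Fin nT → ℝ, (∀ i, 0 < w i) ∧
      (realDiag w - Hᴴ * (1 + H * Q * Hᴴ)⁻¹ * H).PosSemidef ∧
      ∀ R, IsCapacityAchieving H P Ptot R →
        (realDiag w - Hᴴ * (1 + H * Q * Hᴴ)⁻¹ * H) * R = 0 := by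
  set K := 1 + H * Q * Hᴴ with hKdef
  have hK : K⁻¹.PosDef := (posDef_one_add H hQ.1.1).inv
  set G := Hᴴ * K⁻¹ * H with hG
  have hGp : G.PosSemidef := hK.posSemidef.conjTranspose_mul_mul_same H
  have htr : ∀ R, (G * R).trace = (K⁻¹ * (H * R * Hᴴ)).trace := by
    intro R
    rw [hG, Matrix.mul_assoc, Matrix.mul_assoc, Matrix.trace_mul_comm]
    simp only [Matrix.mul_assoc]
  obtain ⟨w, hw, hwR⟩ := exists_realDiag_sub_posSemidef hGp.1 hP hPtot (v := (G * Q).trace.re)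
    fun R hR => by
      have := hQ.trace_nonpos hR
      rw [Matrix.mul_sub, Matrix.sub_mul, Matrix.mul_sub, Matrix.trace_sub, ← hKdef, ← htr,
        ← htr, Complex.sub_re] at this
      linarith
  refine ⟨w, fun i => ?_, hw, fun R hR => hwR R hR.1 ?_⟩
  · have h1 := (Complex.le_def.1 (hw.diag_nonneg (i := i))).1
    have h2 := conjTranspose_mul_mul_apply_self_re_pos hK (hcol i)
    simp only [realDiag, Matrix.sub_apply, Matrix.diagonal_apply_eq, Complex.sub_re,
      Complex.ofReal_re, Complex.zero_re] at h1
    linarith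
  · rw [htr, htr, hQ.mul_mul_conjTranspose_eq hR]

lemma realDiag_mul_realDiag_inv {n : ℕ} {w : Fin n → ℝ} (hw : ∀ i, 0 < w i) :
    realDiag w * realDiag w⁻¹ = 1 := by
  rw [realDiag, realDiag, Matrix.diagonal_mul_diagonal, ← Matrix.diagonal_one]
  congr 1
  ext i
  rw [← Complex.ofReal_mul, Pi.inv_apply, mul_inv_cancel₀ (hw i).ne', Complex.ofReal_one]

lemma posDef_realDiag {n : ℕ} {w : Fin n → ℝ} (hw : ∀ i, 0 < w i) : (realDiag w).PosDef :=
  Matrix.PosDef.diagonal fun i => by exact_mod_cast hw i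

lemma IsCapacityAchieving.eq (hQ : IsCapacityAchieving H P Ptot Q)
    (hR : IsCapacityAchieving H P Ptot R)
    (hcol : ∀ j, ∃ i, H i j ≠ 0) (hP : ∀ i, 0 < P i) (hPtot : 0 ≤ Ptot) : R = Q := by
  obtain ⟨w, hw, -, hwR⟩ := hQ.exists_multiplier hcol hP hPtot
  have hu := (posDef_realDiag hw).isUnit
  have hH : H * (R - Q) * Hᴴ = 0 := by
    rw [Matrix.mul_sub, Matrix.sub_mul, hQ.mul_mul_conjTranspose_eq hR, sub_self]
  -- The multiplier of `Q` also serves `R`. Multiplying by `Hᴴ` on the right gives `(R - Q) Hᴴ = 0`,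
  -- its adjoint gives `H (R - Q) = 0`, and then the right side vanishes.
  have hZ : realDiag w * (R - Q) = Hᴴ * (1 + H * Q * Hᴴ)⁻¹ * (H * (R - Q)) := by
    rw [← sub_eq_zero, ← Matrix.mul_assoc, ← Matrix.sub_mul, Matrix.mul_sub, hwR R hR, hwR Q hQ,
      sub_self]
  have h1 : (R - Q) * Hᴴ = 0 := by
    have : realDiag w * ((R - Q) * Hᴴ) = 0 := by
      rw [← Matrix.mul_assoc, hZ, Matrix.mul_assoc, hH, Matrix.mul_zero]
    rw [← Matrix.one_mul ((R - Q) * Hᴴ),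
      ← Matrix.nonsing_inv_mul _ ((Matrix.isUnit_iff_isUnit_det _).1 hu), Matrix.mul_assoc, this,
      Matrix.mul_zero]
  have h2 : H * (R - Q) = 0 := by
    have := congrArg Matrix.conjTranspose h1
    rwa [Matrix.conjTranspose_mul, Matrix.conjTranspose_conjTranspose,
      (hR.1.1.1.sub hQ.1.1.1).eq, Matrix.conjTranspose_zero] at this
  rw [h2, Matrix.mul_zero, ← mul_zero (realDiag w)] at hZ
  exact sub_eq_zero.1 (hu.mul_left_cancel hZ)

lemma IsCapacityAchieving.exists_hermPosPart_eq (hQ : IsCapacityAchieving H P Ptot Q)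
    (hcol : ∀ j, ∃ i, H i j ≠ 0) (hP : ∀ i, 0 < P i) (hPtot : 0 ≤ Ptot) :
    ∃ d : Fin nT → ℝ, (∀ i, 0 < d i) ∧ hermPosPart (H * realDiag d * Hᴴ - 1) = H * Q * Hᴴ := by
  obtain ⟨w, hw, hZ, hwR⟩ := hQ.exists_multiplier hcol hP hPtot
  have hK := posDef_one_add H hQ.1.1
  have hW := posDef_realDiag hw
  have hWD := realDiag_mul_realDiag_inv hw
  have hKdet := (Matrix.isUnit_iff_isUnit_det _).1 hK.isUnit
  refine ⟨w⁻¹, fun i => inv_pos.2 (hw i), ?_⟩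
  refine hermPosPart_eq_of_eq_sub (C := 1 + H * Q * Hᴴ - H * realDiag w⁻¹ * Hᴴ)
    (hQ.1.1.mul_mul_conjTranspose_same H) ?_ (by abel) ?_
  · have := hK.isUnit.invertible
    have := hW.isUnit.invertible
    rw [← Matrix.inv_eq_right_inv hWD]
    -- Both Schur complements of the block matrix `[K, H; Hᴴ, W]`.
    exact (Matrix.PosDef.fromBlocks₂₂ _ H hW).1 ((Matrix.PosDef.fromBlocks₁₁ H _ hK).2 hZ)
  · set K := 1 + H * Q * Hᴴ with hKdef
    have hB : H * Q * Hᴴ = K - 1 := by rw [hKdef]; abel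
    have h1 : Q * (realDiag w - Hᴴ * K⁻¹ * H) = 0 := by
      have := congrArg Matrix.conjTranspose (hwR Q hQ)
      rwa [Matrix.conjTranspose_mul, hZ.1.eq, hQ.1.1.1.eq, Matrix.conjTranspose_zero] at this
    have h2 : Q = Q * (Hᴴ * K⁻¹ * H) * realDiag w⁻¹ := by
      rw [Matrix.mul_sub, sub_eq_zero] at h1
      rw [← h1, Matrix.mul_assoc, hWD, Matrix.mul_one]
    -- `H Q Hᴴ = K - 1` is a polynomial in `K`.
    have hcomm : H * Q * Hᴴ * K⁻¹ = K⁻¹ * (H * Q * Hᴴ) := by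
      rw [hB, Matrix.sub_mul, Matrix.mul_sub, Matrix.mul_nonsing_inv _ hKdet,
        Matrix.nonsing_inv_mul _ hKdet, Matrix.one_mul, Matrix.mul_one]
    have h3 : H * Q * Hᴴ = K⁻¹ * (H * Q * Hᴴ * (H * realDiag w⁻¹ * Hᴴ)) := by
      rw [← Matrix.mul_assoc, ← hcomm]
      conv_lhs => rw [h2]
      simp only [Matrix.mul_assoc]
    have h4 : K * (H * Q * Hᴴ) = H * Q * Hᴴ * (H * realDiag w⁻¹ * Hᴴ) := by
      conv_lhs => rw [h3]
      rw [← Matrix.mul_assoc, Matrix.mul_nonsing_inv _ hKdet, Matrix.one_mul]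
    rw [Matrix.mul_sub, ← h4, hB, Matrix.sub_mul, Matrix.mul_sub, Matrix.one_mul, Matrix.mul_one,
      sub_self]

end

lemma coupled_of_hermPosPart_eq {nR nT ν : ℕ} {H : Matrix (Fin nR) (Fin nT) ℂ}
    {U : Matrix (Fin nR) (Fin ν) ℂ} {s : Fin ν → ℝ} {V : Matrix (Fin nT) (Fin ν) ℂ}
    (h : IsReducedSVD H U s V) {d : Fin nT → ℝ} {Q : Matrix (Fin nT) (Fin nT) ℂ}
    (hd : hermPosPart (H * realDiag d * Hᴴ - 1) = H * Q * Hᴴ) : Coupled H U s V d Q := by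
  have hu := (Matrix.isUnit_iff_isUnit_det _).1 (posDef_realDiag h.pos).isUnit
  have hl : (realDiag s)⁻¹ * Uᴴ * H = Vᴴ := by
    rw [h.eq, Matrix.mul_assoc _ Uᴴ, ← Matrix.mul_assoc Uᴴ, ← Matrix.mul_assoc Uᴴ, h.left,
      Matrix.one_mul, ← Matrix.mul_assoc, Matrix.nonsing_inv_mul _ hu, Matrix.one_mul]
  have hr : Hᴴ * (U * (realDiag s)⁻¹) = V := by
    rw [← Matrix.conjTranspose_inj, ← hl]
    simp only [Matrix.conjTranspose_mul, Matrix.conjTranspose_conjTranspose,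
      Matrix.conjTranspose_nonsing_inv, (isHermitian_realDiag s).eq]
  rw [Coupled, hd]
  calc Vᴴ * Q * V = (realDiag s)⁻¹ * Uᴴ * H * Q * (Hᴴ * (U * (realDiag s)⁻¹)) := by rw [hl, hr]
    _ = _ := by simp only [Matrix.mul_assoc]

end MIMO

end

theorem theorem2 (nR nT ν : ℕ) (H : Matrix (Fin nR) (Fin nT) ℂ)
    (hcol : ∀ j, ∃ i, H i j ≠ 0) (hrank : H.rank = ν) (hlt : ν < nT)
    (P : Fin nT → ℝ) (hP : ∀ i, 0 < P i) (Ptot : ℝ) (hPtot : 0 ≤ Ptot)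
    (U : Matrix (Fin nR) (Fin ν) ℂ) (s : Fin ν → ℝ) (V : Matrix (Fin nT) (Fin ν) ℂ)
    (hsvd : MIMO.IsReducedSVD H U s V) :
    (∃! Q, MIMO.IsCapacityAchieving H P Ptot Q) ∧
    (∀ Q, MIMO.IsCapacityAchieving H P Ptot Q ↔
      ∃ d, MIMO.IsCoupledSolution H P Ptot U s V d Q) := by
  have hfeas : ∀ Q, MIMO.IsCapacityAchieving H P Ptot Q →
      ∃ d, (d, Q) ∈ MIMO.coupledFeasible H P Ptot U s V := by
    intro Q hQ
    obtain ⟨d, hd, hdQ⟩ := hQ.exists_hermPosPart_eq hcol hP hPtot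
    exact ⟨d, hd, hQ.1.1, hQ.1.2.1, hQ.1.2.2, MIMO.coupled_of_hermPosPart_eq hsvd hdQ⟩
  have hadm : ∀ x ∈ MIMO.coupledFeasible H P Ptot U s V, x.2 ∈ MIMO.admissible P Ptot :=
    fun x hx => ⟨hx.2.1, hx.2.2.1, hx.2.2.2.1⟩
  obtain ⟨Q₀, hQ₀⟩ := MIMO.exists_isCapacityAchieving H hP hPtot
  refine ⟨⟨Q₀, hQ₀, fun R hR => hQ₀.eq hR hcol hP hPtot⟩, fun Q => ⟨fun hQ => ?_, ?_⟩⟩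
  · obtain ⟨d, hd⟩ := hfeas Q hQ
    exact ⟨d, hd, isMinOn_iff.2 fun x hx => neg_le_neg (isMaxOn_iff.1 hQ.2 _ (hadm x hx))⟩
  · rintro ⟨d, hd, hmin⟩
    obtain ⟨d₀, hd₀⟩ := hfeas Q₀ hQ₀
    have hle : -MIMO.mutualInfo H Q ≤ -MIMO.mutualInfo H Q₀ := isMinOn_iff.1 hmin (d₀, Q₀) hd₀
    exact ⟨hadm _ hd, isMaxOn_iff.2 fun R hR =>
      (isMaxOn_iff.1 hQ₀.2 R hR).trans (neg_le_neg_iff.1 hle)⟩
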